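/- **Conventions.** A manifold is a smooth manifold of some fixed finite dimension without boundary; it is not assumed Hausdorff or second countable unless this is said. A *Lie groupoid* $\mathcal G\rightrightarrows G_0$ is a small category with invertible arrows whose base $G_0$ is a Hausdorff, second-countable manifold, whose arrow space $\mathcal G$ is a manifold, whose structure maps are smooth, and whose source map $s$ is a submersion with Hausdorff fibres; $t$ denotes the target map. Its orbit space $G_0/\mathcal G$ is the quotient of $G_0$ by the relation $x\sim y$ iff there is an arrow from $x$ to $y$, with the quotient diffeology: the plots are the maps into $G_0/\mathcal G$ that lift, locally, to smooth maps into $G_0$ along the projection $\pi_{\mathcal G}:G_0\to G_0/\mathcal G$. A *diffeological $k$-form* on a diffeological space assigns to each plot $P:U\to X$ a smooth $k$-form $\alpha(P)\in\Omega^k(U)$ such that $\alpha(P\circ F)=F^*(\alpha(P))$ for all smooth maps $F$ between open subsets of Cartesian spaces, and the pullback by a smooth map $f$ is $(f^*\alpha)(P)=\alpha(f\circ P)$. A differential form $\alpha$ on a manifold is identified with the diffeological form $P\mapsto P^*\alpha$. A form $\alpha\in\Omega^k(G_0)$ is *$\mathcal G$-basic* if $s^*\alpha=t^*\alpha$; write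 $\Omega^k_b(G_0,\mathcal G)$ for the set of these. The groupoid $\mathcal G$ has *property (P)* if, for every $k\ge 0$, $\pi_{\mathcal G}^*$ is a bijection of $\Omega^k(G_0/\mathcal G)$ onto $\Omega^k_b(G_0,\mathcal G)$. Lie groupoids $\mathcal G\rightrightarrows G_0$ and $\mathcal H\rightrightarrows H_0$ are *Morita equivalent* if there are a manifold $P$ and commuting smooth actions of $\mathcal G$ on $P$ from the left, with anchor $a_L:P\to G_0$, and of $\mathcal H$ on $P$ from the right, with anchor $a_R:P\to H_0$, such that $a_L$ is an $\mathcal H$-invariant surjective submersion, $a_R$ is a $\mathcal G$-invariant surjective submersion, and the maps $P\times_{a_R,H_0,t}\mathcal H\to P\times_{G_0}P$, $(p,h)\mapsto(p,p\cdot h)$, and $\mathcal G\times_{s,G_0,a_L}P\to P\times_{H_0}P$, $(g,p)\mapsto(g\cdot p,p)$, are diffeomorphisms. **Statement.** Let $\mathcal G\rightrightarrows G_0$ and $\mathcal H\rightrightarrows H_0$ be Morita equivalent Lie groupoids. Then for every $k\ge 0$, the pullback $\pi_{\mathcal G}^*:\Omega^k(G_0/\mathcal G)\to\Omega^k(G_0)$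 surjects onto the $\mathcal G$-basic $k$-forms if and only if $\pi_{\mathcal H}^*:\Omega^k(H_0/\mathcal H)\to\Omega^k(H_0)$ surjects onto the $\mathcal H$-basic $k$-forms. Consequently, $\mathcal G$ has property (P) if and only if $\mathcal H$ has property (P). -/

import Mathlib

open scoped Manifold ContDiff Topology

noncomputable section

/-! ### Diffeologies on manifolds and on quotients

Mathlib's `DiffeologicalSpace X` records the plots whose domain is a full Cartesian space; by
locality these determine, and are determined by, the plots on arbitrary open subsets of Cartesian
spaces. -/

/-- A smooth map that is the identity near `x` and takes its values in a given neighbourhood of `x`. -/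
theorem exists_contDiff_into_eventually_id {d : ℕ} {x : EuclideanSpace ℝ (Fin d)}
    {v : Set (EuclideanSpace ℝ (Fin d))} (hv : v ∈ 𝓝 x) :
    ∃ f : EuclideanSpace ℝ (Fin d) → EuclideanSpace ℝ (Fin d),
      ContDiff ℝ ∞ f ∧ (∀ y, f y ∈ v) ∧ ∀ᶠ y in 𝓝 x, f y = y := by
  obtain ⟨ε, hε, hball⟩ := Metric.mem_nhds_iff.1 hv
  let χ : ContDiffBump x := ⟨ε / 2, ε, by positivity, by linarith⟩
  refine ⟨fun y ↦ x + χ y • (y - x), ?_, fun y ↦ hball ?_, ?_⟩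
  · exact contDiff_const.add (χ.contDiff.smul (contDiff_id.sub contDiff_const))
  · rw [Metric.mem_ball, dist_eq_norm, add_sub_cancel_left, norm_smul, Real.norm_eq_abs,
      abs_of_nonneg χ.nonneg]
    by_cases h : dist y x < ε
    · rw [dist_eq_norm] at h
      exact lt_of_le_of_lt (mul_le_of_le_one_left (norm_nonneg _) χ.le_one) h
    · rw [χ.zero_of_le_dist (not_lt.1 h), zero_mul]
      exact hε
  · filter_upwards [χ.eventuallyEq_one] with y hy
    rw [hy]
    simp

/-- The diffeology of a manifold: the plots are the smooth maps from Cartesian spaces. -/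
@[reducible]
def manifoldDiffeology (n : ℕ) (M : Type*) [TopologicalSpace M]
    [ChartedSpace (EuclideanSpace ℝ (Fin n)) M] : DiffeologicalSpace M where
  plots d := {p | ContMDiff (𝓡 d) (𝓡 n) ∞ p}
  constant_plots _ := contMDiff_const
  plot_reparam hp hf := ContMDiff.comp hp hf.contMDiff
  locality := by
    intro d p hp x
    obtain ⟨u, hu, hxu, h⟩ := hp x
    obtain ⟨f, hf, hfu, hfx⟩ := exists_contDiff_into_eventually_id (hu.mem_nhds hxu)
    refine ((h hfu hf) x).congr_of_eventuallyEq ?_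
    filter_upwards [hfx] with y hy
    simp [hy]

/-- The quotient diffeology: a parametrization is a plot iff it lifts, locally, to plots of `X`. -/
@[reducible]
def quotientDiffeology {X : Type*} (D : DiffeologicalSpace X) (r : Setoid X) :
    DiffeologicalSpace (Quotient r) where
  plots d := {p | ∀ x, ∃ q ∈ D.plots d, ∀ᶠ y in 𝓝 x, p y = Quotient.mk r (q y)}
  constant_plots {d} x₀ := by
    induction x₀ using Quotient.inductionOn with
    | h a => exact fun _ ↦ ⟨fun _ ↦ a, D.constant_plots a, Filter.Eventually.of_forall fun _ ↦ rfl⟩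
  plot_reparam := by
    intro n m p f hp hf x
    obtain ⟨q, hq, h⟩ := hp (f x)
    exact ⟨q ∘ f, D.plot_reparam hq hf, hf.continuous.continuousAt.eventually h⟩
  locality := by
    intro d p hp x
    obtain ⟨u, hu, hxu, h⟩ := hp x
    obtain ⟨f, hf, hfu, hfx⟩ := exists_contDiff_into_eventually_id (hu.mem_nhds hxu)
    obtain ⟨q, hq, hpq⟩ := h hfu hf x
    refine ⟨q, hq, ?_⟩
    filter_upwards [hfx, hpq] with y hy hy'
    rw [← hy', Function.comp_apply, hy]

/-- The projection to a quotient is smooth. -/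
theorem dSmooth_quotientMk {X : Type*} (D : DiffeologicalSpace X) (r : Setoid X) :
    @Diffeology.DSmooth X (Quotient r) D (quotientDiffeology D r) (Quotient.mk r) :=
  fun _ p hp _ ↦ ⟨p, hp, Filter.Eventually.of_forall fun _ ↦ rfl⟩

/-! ### Diffeological forms -/

/-- A diffeological `k`-form on `(X, D)`: a smooth `k`-form on the domain of each plot, compatible
with all smooth changes of parameters. -/
@[ext]
structure DiffForm {X : Type*} (D : DiffeologicalSpace X) (k : ℕ) where
  toFun : ∀ (d : ℕ) (p : EuclideanSpace ℝ (Fin d) → X), p ∈ D.plots d →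
    EuclideanSpace ℝ (Fin d) → EuclideanSpace ℝ (Fin d) [⋀^Fin k]→L[ℝ] ℝ
  contDiff : ∀ (d : ℕ) (p : EuclideanSpace ℝ (Fin d) → X) (hp : p ∈ D.plots d),
    ContDiff ℝ ∞ (toFun d p hp)
  reparam : ∀ (d e : ℕ) (p : EuclideanSpace ℝ (Fin d) → X) (hp : p ∈ D.plots d)
    (f : EuclideanSpace ℝ (Fin e) → EuclideanSpace ℝ (Fin d)) (hf : ContDiff ℝ ∞ f)
    (x : EuclideanSpace ℝ (Fin e)),
    toFun e (p ∘ f) (D.plot_reparam hp hf) x =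
      (toFun d p hp (f x)).compContinuousLinearMap (fderiv ℝ f x)

/-- The pullback of diffeological forms along a smooth map. -/
def DiffForm.pullback {X Y : Type*} {D : DiffeologicalSpace X} {D' : DiffeologicalSpace Y} {k : ℕ}
    (f : X → Y) (hf : @Diffeology.DSmooth X Y D D' f) (β : DiffForm D' k) : DiffForm D k where
  toFun d p hp := β.toFun d (f ∘ p) (hf d p hp)
  contDiff d p hp := β.contDiff d (f ∘ p) (hf d p hp)
  reparam d e p hp g hg x := β.reparam d e (f ∘ p) (hf d p hp) g hg x

/-! ### Differential forms on manifolds -/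

/-- A (smooth) differential `k`-form on an `n`-manifold `M`: a smooth section of the bundle of
alternating `k`-linear forms on the tangent spaces. -/
abbrev ManifoldForm (n k : ℕ) (M : Type*) [TopologicalSpace M]
    [ChartedSpace (EuclideanSpace ℝ (Fin n)) M] [IsManifold (𝓡 n) ∞ M] :=
  ContMDiffSection (𝓡 n) (EuclideanSpace ℝ (Fin n) [⋀^Fin k]→L[ℝ] ℝ) ∞
    (fun x : M ↦ TangentSpace (𝓡 n) x [⋀^Fin k]→L[ℝ] Bundle.Trivial M ℝ x)

/-- The value at `x` of the pullback `f^* α` of a differential form. -/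
def ManifoldForm.pullbackAt {n n' k : ℕ} {M N : Type*} [TopologicalSpace M]
    [ChartedSpace (EuclideanSpace ℝ (Fin n)) M] [IsManifold (𝓡 n) ∞ M] [TopologicalSpace N]
    [ChartedSpace (EuclideanSpace ℝ (Fin n')) N] (f : N → M) (α : ManifoldForm n k M) (x : N) :
    TangentSpace (𝓡 n') x [⋀^Fin k]→L[ℝ] ℝ :=
  ContinuousAlternatingMap.compContinuousLinearMap
    (show TangentSpace (𝓡 n) (f x) [⋀^Fin k]→L[ℝ] ℝ from α (f x)) (mfderiv (𝓡 n') (𝓡 n) f x)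

/-- A family of alternating forms is smooth if its values on all tuples of vectors are. -/
theorem contDiffAt_alternating_of_apply {E F : Type*} [NormedAddCommGroup E] [NormedSpace ℝ E]
    [NormedAddCommGroup F] [NormedSpace ℝ F] [FiniteDimensional ℝ F] {k : ℕ}
    {w : E → F [⋀^Fin k]→L[ℝ] ℝ} {x : E}
    (h : ∀ v : Fin k → F, ContDiffAt ℝ ∞ (fun y ↦ w y v) x) : ContDiffAt ℝ ∞ w x := by
  let b := Module.finBasis ℝ F
  let ev : (F [⋀^Fin k]→L[ℝ] ℝ) →ₗ[ℝ] ((Fin k → Fin (Module.finrank ℝ F)) → ℝ) :=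
    { toFun := fun a s ↦ a (fun i ↦ b (s i))
      map_add' := fun _ _ ↦ rfl
      map_smul' := fun _ _ ↦ rfl }
  have hinj : LinearMap.ker ev = ⊥ := by
    refine LinearMap.ker_eq_bot.2 fun a a' haa ↦ ?_
    refine ContinuousAlternatingMap.toAlternatingMap_injective
      (AlternatingMap.coe_multilinearMap_injective (Module.Basis.ext_multilinear (fun _ ↦ b) ?_))
    exact fun s ↦ congrFun haa s
  obtain ⟨g, hg⟩ := ev.exists_leftInverse_of_injective hinj
  have hw : w = fun y ↦ LinearMap.toContinuousLinearMap g (ev (w y)) := by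
    funext y
    exact (LinearMap.congr_fun hg (w y)).symm
  rw [hw]
  refine (ContinuousLinearMap.contDiff _).contDiffAt.comp x ?_
  exact contDiffAt_pi.2 fun s ↦ h _

/-- The pullback of a smooth family of alternating forms by a smooth family of linear maps is smooth. -/
theorem contDiffAt_alternating_comp {E F F' : Type*} [NormedAddCommGroup E] [NormedSpace ℝ E]
    [NormedAddCommGroup F] [NormedSpace ℝ F] [NormedAddCommGroup F'] [NormedSpace ℝ F']
    [FiniteDimensional ℝ F'] {k : ℕ} {w : E → F [⋀^Fin k]→L[ℝ] ℝ} {L : E → F' →L[ℝ] F} {x : E}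
    (hw : ContDiffAt ℝ ∞ w x) (hL : ContDiffAt ℝ ∞ L x) :
    ContDiffAt ℝ ∞ (fun y ↦ (w y).compContinuousLinearMap (L y)) x := by
  refine contDiffAt_alternating_of_apply fun v ↦ ?_
  have h1 : ContDiffAt ℝ ∞ (fun y ↦
      ContinuousMultilinearMap.compContinuousLinearMapContinuousMultilinear ℝ
        (fun _ : Fin k ↦ F') (fun _ ↦ F) ℝ (fun _ ↦ L y)) x :=
    (ContinuousMultilinearMap.contDiff _).contDiffAt.comp x (contDiffAt_pi.2 fun _ ↦ hL)
  have h2 : ContDiffAt ℝ ∞ (fun y ↦ (w y).toContinuousMultilinearMap) x :=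
    let T : (F [⋀^Fin k]→L[ℝ] ℝ) →L[ℝ] ContinuousMultilinearMap ℝ (fun _ : Fin k ↦ F) ℝ :=
      ContinuousAlternatingMap.toContinuousMultilinearMapCLM ℝ
    T.contDiff.contDiffAt.comp x hw
  exact (ContinuousMultilinearMap.apply ℝ (fun _ : Fin k ↦ F') ℝ v).contDiff.contDiffAt.comp x
    (h1.clm_apply h2)

/-- The diffeological form `P ↦ P^* α` of a differential form `α` on a manifold. -/
def ManifoldForm.toDiffForm {n k : ℕ} {M : Type*} [TopologicalSpace M]
    [ChartedSpace (EuclideanSpace ℝ (Fin n)) M] [IsManifold (𝓡 n) ∞ M] (α : ManifoldForm n k M) :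
    DiffForm (manifoldDiffeology n M) k where
  toFun d p _ x := ManifoldForm.pullbackAt p α x
  contDiff d p hp := by
    replace hp : ContMDiff (𝓡 d) (𝓡 n) ∞ p := hp
    refine contDiff_iff_contDiffAt.2 fun x₀ ↦ ?_
    have h1 := ((Bundle.contMDiffAt_section _).1 (α.contMDiff (p x₀))).comp x₀ (hp x₀)
    have h2 := (hp x₀).mfderiv_const (m := ∞) (by simp)
    refine (contDiffAt_alternating_comp h1.contDiffAt h2.contDiffAt).congr_of_eventuallyEq ?_
    have hs : ∀ᶠ x in 𝓝 x₀, p x ∈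
        (trivializationAt (EuclideanSpace ℝ (Fin n)) (TangentSpace (𝓡 n)) (p x₀)).baseSet :=
      (hp.continuous.continuousAt (x := x₀)).eventually
        ((trivializationAt (EuclideanSpace ℝ (Fin n)) (TangentSpace (𝓡 n))
          (p x₀)).open_baseSet.mem_nhds (FiberBundle.mem_baseSet_trivializationAt' (p x₀)))
    filter_upwards [hs] with x hx
    ext v
    simp only [Function.comp_apply, FiberBundle.trivializationAt_continuousAlternatingMap_apply,
      ContinuousAlternatingMap.inCoordinates, ContinuousAlternatingMap.compContinuousLinearMap_apply,
      inTangentCoordinates, ManifoldForm.pullbackAt, ContinuousLinearMap.inCoordinates,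
      Function.comp_def]
    simp only [Bundle.Trivial.continuousLinearMapAt_trivialization,
      Bundle.Trivial.fiberBundle_trivializationAt', id_eq]
    change (α (p x)) (fun i ↦ mfderiv (𝓡 d) (𝓡 n) p x (v i)) = (α (p x)) (fun i ↦
        (trivializationAt (EuclideanSpace ℝ (Fin n)) (TangentSpace (𝓡 n)) (p x₀)).symmL ℝ (p x)
          ((trivializationAt (EuclideanSpace ℝ (Fin n)) (TangentSpace (𝓡 n)) (p x₀)).continuousLinearMapAt ℝ
            (p x) (mfderiv (𝓡 d) (𝓡 n) p x _)))
    refine congrArg (α (p x)) (funext fun i ↦ ?_)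
    rw [Bundle.Trivialization.symmL_continuousLinearMapAt _ hx]
    simp
    rfl
  reparam d e p hp f hf x := by
    have hp' : MDifferentiableAt (𝓡 d) (𝓡 n) p (f x) :=
      (ContMDiff.mdifferentiable hp (by simp)) (f x)
    have hf' : MDifferentiableAt (𝓡 e) (𝓡 d) f x :=
      ((hf.contMDiff).mdifferentiable (by simp)) x
    have h := mfderiv_comp x hp' hf'
    rw [mfderiv_eq_fderiv] at h
    unfold ManifoldForm.pullbackAt
    rw [h]
    rfl

/-! ### Lie groupoids, their orbit spaces and their basic forms -/

/-- A Lie groupoid with arrow space `G` (an `m`-manifold, not necessarily Hausdorff or second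
countable) over the Hausdorff, second countable `n`-manifold `M`. An arrow `g` goes from `src g` to
`tgt g`, and `mul g h` is the composite "`g` after `h`"; only its values on composable pairs
(`src g = tgt h`) are meaningful. Smoothness of the multiplication is smoothness on the embedded
submanifold of composable pairs of `G × G`. -/
structure LieGroupoid (n m : ℕ) (M G : Type*)
    [TopologicalSpace M] [ChartedSpace (EuclideanSpace ℝ (Fin n)) M] [IsManifold (𝓡 n) ∞ M]
    [T2Space M] [SecondCountableTopology M]
    [TopologicalSpace G] [ChartedSpace (EuclideanSpace ℝ (Fin m)) G] [IsManifold (𝓡 m) ∞ G] where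
  src : G → M
  tgt : G → M
  unit : M → G
  inv : G → G
  mul : G → G → G
  src_mul : ∀ g h, src g = tgt h → src (mul g h) = src h
  tgt_mul : ∀ g h, src g = tgt h → tgt (mul g h) = tgt g
  mul_assoc : ∀ g h l, src g = tgt h → src h = tgt l → mul (mul g h) l = mul g (mul h l)
  src_unit : ∀ x, src (unit x) = x
  tgt_unit : ∀ x, tgt (unit x) = x
  unit_mul : ∀ g, mul (unit (tgt g)) g = g
  mul_unit : ∀ g, mul g (unit (src g)) = g
  src_inv : ∀ g, src (inv g) = tgt g
  tgt_inv : ∀ g, tgt (inv g) = src g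
  inv_mul : ∀ g, mul (inv g) g = unit (src g)
  mul_inv : ∀ g, mul g (inv g) = unit (tgt g)
  smooth_src : ContMDiff (𝓡 m) (𝓡 n) ∞ src
  smooth_tgt : ContMDiff (𝓡 m) (𝓡 n) ∞ tgt
  smooth_unit : ContMDiff (𝓡 n) (𝓡 m) ∞ unit
  smooth_inv : ContMDiff (𝓡 m) (𝓡 m) ∞ inv
  smooth_mul : ContMDiffOn ((𝓡 m).prod (𝓡 m)) (𝓡 m) ∞ (fun q : G × G ↦ mul q.1 q.2)
    {q | src q.1 = tgt q.2}
  submersion_src : Manifold.IsSubmersion (𝓡 m) (𝓡 n) ∞ src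
  t2_fiber : ∀ x, T2Space (src ⁻¹' {x})

namespace LieGroupoid

variable {n m : ℕ} {M G : Type*}
  [TopologicalSpace M] [ChartedSpace (EuclideanSpace ℝ (Fin n)) M] [IsManifold (𝓡 n) ∞ M]
  [T2Space M] [SecondCountableTopology M]
  [TopologicalSpace G] [ChartedSpace (EuclideanSpace ℝ (Fin m)) G] [IsManifold (𝓡 m) ∞ G]

/-- The orbit relation: `x ∼ y` iff there is an arrow from `x` to `y`. -/
def orbitSetoid (𝓖 : LieGroupoid n m M G) : Setoid M where
  r x y := ∃ g, 𝓖.src g = x ∧ 𝓖.tgt g = y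
  iseqv :=
    { refl := fun x ↦ ⟨𝓖.unit x, 𝓖.src_unit x, 𝓖.tgt_unit x⟩
      symm := by
        rintro _ _ ⟨g, rfl, rfl⟩
        exact ⟨𝓖.inv g, 𝓖.src_inv g, 𝓖.tgt_inv g⟩
      trans := by
        rintro _ _ _ ⟨g, rfl, rfl⟩ ⟨h, hs, rfl⟩
        exact ⟨𝓖.mul h g, 𝓖.src_mul h g hs, 𝓖.tgt_mul h g hs⟩ }

/-- The orbit space `M / 𝓖`. -/
abbrev OrbitSpace (𝓖 : LieGroupoid n m M G) : Type _ := Quotient 𝓖.orbitSetoid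

/-- The quotient diffeology of the orbit space. -/
abbrev orbitDiffeology (𝓖 : LieGroupoid n m M G) : DiffeologicalSpace 𝓖.OrbitSpace :=
  quotientDiffeology (manifoldDiffeology n M) 𝓖.orbitSetoid

/-- The pullback `π^* : Ω^k(M / 𝓖) → Ω^k(M)` by the projection `π : M → M / 𝓖`. -/
def orbitPullback (𝓖 : LieGroupoid n m M G) (k : ℕ) :
    DiffForm 𝓖.orbitDiffeology k → DiffForm (manifoldDiffeology n M) k :=
  DiffForm.pullback (Quotient.mk 𝓖.orbitSetoid)
    (dSmooth_quotientMk (manifoldDiffeology n M) 𝓖.orbitSetoid)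

/-- A differential form `α` on the base is `𝓖`-basic if `s^* α = t^* α`. -/
def IsBasic (𝓖 : LieGroupoid n m M G) {k : ℕ} (α : ManifoldForm n k M) : Prop :=
  ∀ g : G, (α.pullbackAt 𝓖.src g : TangentSpace (𝓡 m) g [⋀^Fin k]→L[ℝ] ℝ) =
    α.pullbackAt 𝓖.tgt g

/-- The `𝓖`-basic `k`-forms, regarded as diffeological forms on the base. -/
def basicForms (𝓖 : LieGroupoid n m M G) (k : ℕ) : Set (DiffForm (manifoldDiffeology n M) k) :=
  {γ | ∃ α : ManifoldForm n k M, 𝓖.IsBasic α ∧ α.toDiffForm = γ}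

/-- The pullback by the projection to the orbit space surjects onto the `𝓖`-basic `k`-forms. -/
def SurjectsOntoBasicForms (𝓖 : LieGroupoid n m M G) (k : ℕ) : Prop :=
  Set.SurjOn (𝓖.orbitPullback k) Set.univ (𝓖.basicForms k)

/-- Property (P): in every degree, the pullback by the projection to the orbit space is a bijection
from the diffeological forms on the orbit space onto the `𝓖`-basic forms. -/
def PropertyP (𝓖 : LieGroupoid n m M G) : Prop :=
  ∀ k, Set.BijOn (𝓖.orbitPullback k) Set.univ (𝓖.basicForms k)

end LieGroupoid

/-! ### Actions, principal bundles and Morita equivalence -/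

/-- `f` restricts to a diffeomorphism from `S` onto `T`, where `S` and `T` are embedded submanifolds
of `X` and `Y`. -/
def IsDiffeoOn {E E' H H' X Y : Type*} [NormedAddCommGroup E] [NormedSpace ℝ E]
    [NormedAddCommGroup E'] [NormedSpace ℝ E'] [TopologicalSpace H] [TopologicalSpace H']
    (I : ModelWithCorners ℝ E H) (I' : ModelWithCorners ℝ E' H')
    [TopologicalSpace X] [ChartedSpace H X] [TopologicalSpace Y] [ChartedSpace H' Y]
    (f : X → Y) (S : Set X) (T : Set Y) : Prop :=
  ContMDiffOn I I' ∞ f S ∧ Set.MapsTo f S T ∧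
    ∃ g : Y → X, ContMDiffOn I' I ∞ g T ∧ Set.MapsTo g T S ∧ Set.InvOn g f S T

section Actions

variable {n m d : ℕ} {M G : Type*}
  [TopologicalSpace M] [ChartedSpace (EuclideanSpace ℝ (Fin n)) M] [IsManifold (𝓡 n) ∞ M]
  [T2Space M] [SecondCountableTopology M]
  [TopologicalSpace G] [ChartedSpace (EuclideanSpace ℝ (Fin m)) G] [IsManifold (𝓡 m) ∞ G]

/-- A right action of a Lie groupoid on a manifold `P`: an anchor `a : P → M` and a multiplication
`(p, h) ↦ p · h`, meaningful when `a p = tgt h`. -/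
structure RightAction (𝓗 : LieGroupoid n m M G) (d : ℕ) (P : Type*)
    [TopologicalSpace P] [ChartedSpace (EuclideanSpace ℝ (Fin d)) P] where
  anchor : P → M
  act : P → G → P
  smooth_anchor : ContMDiff (𝓡 d) (𝓡 n) ∞ anchor
  smooth_act : ContMDiffOn ((𝓡 d).prod (𝓡 m)) (𝓡 d) ∞ (fun q : P × G ↦ act q.1 q.2)
    {q | anchor q.1 = 𝓗.tgt q.2}
  anchor_act : ∀ p h, anchor p = 𝓗.tgt h → anchor (act p h) = 𝓗.src h
  act_act : ∀ p h h', anchor p = 𝓗.tgt h → 𝓗.src h = 𝓗.tgt h' →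
    act (act p h) h' = act p (𝓗.mul h h')
  act_unit : ∀ p, act p (𝓗.unit (anchor p)) = p

/-- A left action of a Lie groupoid on a manifold `P`: an anchor `a : P → M` and a multiplication
`(g, p) ↦ g · p`, meaningful when `src g = a p`. -/
structure LeftAction (𝓖 : LieGroupoid n m M G) (d : ℕ) (P : Type*)
    [TopologicalSpace P] [ChartedSpace (EuclideanSpace ℝ (Fin d)) P] where
  anchor : P → M
  act : G → P → P
  smooth_anchor : ContMDiff (𝓡 d) (𝓡 n) ∞ anchor
  smooth_act : ContMDiffOn ((𝓡 m).prod (𝓡 d)) (𝓡 d) ∞ (fun q : G × P ↦ act q.1 q.2)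
    {q | 𝓖.src q.1 = anchor q.2}
  anchor_act : ∀ g p, 𝓖.src g = anchor p → anchor (act g p) = 𝓖.tgt g
  act_act : ∀ g g' p, 𝓖.src g = 𝓖.tgt g' → 𝓖.src g' = anchor p →
    act g (act g' p) = act (𝓖.mul g g') p
  unit_act : ∀ p, act (𝓖.unit (anchor p)) p = p

variable {P : Type*} [TopologicalSpace P] [ChartedSpace (EuclideanSpace ℝ (Fin d)) P]

/-- A right action makes `π : P → B` a principal bundle: `π` is an invariant surjective submersion
and `(p, h) ↦ (p, p · h)` is a diffeomorphism of `P ×_M G` onto `P ×_B P`. -/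
structure RightAction.IsPrincipal {𝓗 : LieGroupoid n m M G} (A : RightAction 𝓗 d P)
    (b : ℕ) {B : Type*} [TopologicalSpace B] [ChartedSpace (EuclideanSpace ℝ (Fin b)) B]
    (π : P → B) : Prop where
  surjective : Function.Surjective π
  submersion : Manifold.IsSubmersion (𝓡 d) (𝓡 b) ∞ π
  invariant : ∀ p h, A.anchor p = 𝓗.tgt h → π (A.act p h) = π p
  diffeo : IsDiffeoOn ((𝓡 d).prod (𝓡 m)) ((𝓡 d).prod (𝓡 d))
    (fun q : P × G ↦ (q.1, A.act q.1 q.2)) {q | A.anchor q.1 = 𝓗.tgt q.2} {q | π q.1 = π q.2}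

/-- A left action makes `π : P → B` a principal bundle: `π` is an invariant surjective submersion
and `(g, p) ↦ (g · p, p)` is a diffeomorphism of `G ×_M P` onto `P ×_B P`. -/
structure LeftAction.IsPrincipal {𝓖 : LieGroupoid n m M G} (A : LeftAction 𝓖 d P)
    (b : ℕ) {B : Type*} [TopologicalSpace B] [ChartedSpace (EuclideanSpace ℝ (Fin b)) B]
    (π : P → B) : Prop where
  surjective : Function.Surjective π
  submersion : Manifold.IsSubmersion (𝓡 d) (𝓡 b) ∞ π
  invariant : ∀ g p, 𝓖.src g = A.anchor p → π (A.act g p) = π p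
  diffeo : IsDiffeoOn ((𝓡 m).prod (𝓡 d)) ((𝓡 d).prod (𝓡 d))
    (fun q : G × P ↦ (A.act q.1 q.2, q.2)) {q | 𝓖.src q.1 = A.anchor q.2} {q | π q.1 = π q.2}

end Actions

section Morita

variable {n m n' m' : ℕ} {M G N H : Type*}
  [TopologicalSpace M] [ChartedSpace (EuclideanSpace ℝ (Fin n)) M] [IsManifold (𝓡 n) ∞ M]
  [T2Space M] [SecondCountableTopology M]
  [TopologicalSpace G] [ChartedSpace (EuclideanSpace ℝ (Fin m)) G] [IsManifold (𝓡 m) ∞ G]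
  [TopologicalSpace N] [ChartedSpace (EuclideanSpace ℝ (Fin n')) N] [IsManifold (𝓡 n') ∞ N]
  [T2Space N] [SecondCountableTopology N]
  [TopologicalSpace H] [ChartedSpace (EuclideanSpace ℝ (Fin m')) H] [IsManifold (𝓡 m') ∞ H]

/-- A bibundle `P : 𝓖 → 𝓗`: commuting actions of `𝓖` from the left and of `𝓗` from the right, such
that the left anchor is a principal right `𝓗`-bundle and the right anchor is `𝓖`-invariant. -/
structure Bibundle (𝓖 : LieGroupoid n m M G) (𝓗 : LieGroupoid n' m' N H) (d : ℕ) (P : Type*)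
    [TopologicalSpace P] [ChartedSpace (EuclideanSpace ℝ (Fin d)) P] where
  left : LeftAction 𝓖 d P
  right : RightAction 𝓗 d P
  principal_right : right.IsPrincipal n left.anchor
  right_anchor_invariant : ∀ g p, 𝓖.src g = left.anchor p →
    right.anchor (left.act g p) = right.anchor p
  act_comm : ∀ g p h, 𝓖.src g = left.anchor p → right.anchor p = 𝓗.tgt h →
    right.act (left.act g p) h = left.act g (right.act p h)

universe w

/-- `𝓖` and `𝓗` are Morita equivalent: there is a bibundle `P : 𝓖 → 𝓗` whose right anchor is a
principal left `𝓖`-bundle. The manifold `P` need not be Hausdorff or second countable. -/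
def MoritaEquivalent (𝓖 : LieGroupoid n m M G) (𝓗 : LieGroupoid n' m' N H) : Prop :=
  ∃ (d : ℕ) (P : Type w) (_ : TopologicalSpace P)
    (_ : ChartedSpace (EuclideanSpace ℝ (Fin d)) P) (_ : IsManifold (𝓡 d) ∞ P)
    (B : Bibundle 𝓖 𝓗 d P), B.left.IsPrincipal n' B.right.anchor

end Morita

end

open scoped Manifold ContDiff Topology

/-! Two conditions on a form on the base are compared, both tested on plots. A form is basic when it
agrees on `src ∘ g` and `tgt ∘ g` for each smooth family of arrows `g`
(`LieGroupoid.isBasic_iff_toFun_eq`). It comes from the orbit space when it agrees on any two plots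
that lie in the same orbit at each parameter, with no smooth family of arrows required
(`DiffForm.mem_range_pullback_iff`). Surjectivity in degree `k` thus says that every basic `k`-form
descends in the second sense. Injectivity always holds, since plots of the orbit space lift locally
by definition, so (P) is surjectivity in all degrees.

Let `P` be the bibundle and `α` a basic form on the base of `𝓗`. Two plots of `P` with the same left
projection differ by a smooth family of arrows of `𝓗`, because the division map is smooth; hence the
pullback of `α` to `P` descends along the left anchor to a form `α'`, and the action of `𝓖` on `P`
shows that `α'` is basic (`PlotCorrespondence.exists_isBasic_pullback_eq`). If `α'` descends to the
orbit space of `𝓖`, then `α` descends to that of `𝓗`: plots lift locally to `P`, and points of `P`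
over one `𝓗`-orbit lie over one `𝓖`-orbit. The data used are symmetric in the two groupoids, which
gives the converse. -/

noncomputable section

/-! ### Descent of diffeological forms along maps with local lifts -/

namespace DiffForm

variable {X Y : Type*} {D : DiffeologicalSpace X} {D' : DiffeologicalSpace Y} {k : ℕ}

theorem toFun_congr (γ : DiffForm D k) {d : ℕ} {p q : EuclideanSpace ℝ (Fin d) → X}
    (h : p = q) (hp : p ∈ D.plots d) (hq : q ∈ D.plots d) : γ.toFun d p hp = γ.toFun d q hq := by
  subst h
  rfl

/-- The value of a diffeological form on a plot at a point depends only on the germ of the plot. -/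
theorem toFun_eq_of_eventuallyEq (γ : DiffForm D k) {d : ℕ} {p q : EuclideanSpace ℝ (Fin d) → X}
    (hp : p ∈ D.plots d) (hq : q ∈ D.plots d) {x : EuclideanSpace ℝ (Fin d)}
    (h : ∀ᶠ y in 𝓝 x, p y = q y) : γ.toFun d p hp x = γ.toFun d q hq x := by
  -- Plots live on whole Cartesian spaces, so restriction to a neighbourhood is replaced by
  -- composition with `f`: then `p ∘ f = q ∘ f` everywhere, while the derivative of `f` at `x` is
  -- the identity.
  obtain ⟨f, hf, hfu, hfx⟩ := exists_contDiff_into_eventually_id h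
  have hid : fderiv ℝ f x = ContinuousLinearMap.id ℝ _ := by
    rw [Filter.EventuallyEq.fderiv_eq (f₁ := f) (f := id) hfx, fderiv_id]
  have key (r : EuclideanSpace ℝ (Fin d) → X) (hr : r ∈ D.plots d) :
      γ.toFun d (r ∘ f) (D.plot_reparam hr hf) x = γ.toFun d r hr x := by
    rw [γ.reparam d d r hr f hf x, hid, hfx.self_of_nhds]
    rfl
  rw [← key p hp, ← key q hq]
  exact congrFun (γ.toFun_congr (funext hfu) _ _) x

/-- A parametrization of `Y` lifts locally along `π` to plots of `X`. -/
def LiftsLocally (D : DiffeologicalSpace X) (π : X → Y) {d : ℕ}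
    (r : EuclideanSpace ℝ (Fin d) → Y) : Prop :=
  ∀ x, ∃ p ∈ D.plots d, ∀ᶠ y in 𝓝 x, r y = π (p y)

/-- A form descends along `π` if it agrees on plots with the same projection. -/
def Descends (π : X → Y) (γ : DiffForm D k) : Prop :=
  ∀ (d : ℕ) (p q : EuclideanSpace ℝ (Fin d) → X) (hp : p ∈ D.plots d) (hq : q ∈ D.plots d),
    π ∘ p = π ∘ q → γ.toFun d p hp = γ.toFun d q hq

theorem Descends.toFun_eq {π : X → Y} {γ : DiffForm D k} (hγ : γ.Descends π) {d : ℕ}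
    {p q : EuclideanSpace ℝ (Fin d) → X} (hp : p ∈ D.plots d) (hq : q ∈ D.plots d)
    {x : EuclideanSpace ℝ (Fin d)} (h : ∀ᶠ y in 𝓝 x, π (p y) = π (q y)) :
    γ.toFun d p hp x = γ.toFun d q hq x := by
  obtain ⟨f, hf, hfu, hfx⟩ := exists_contDiff_into_eventually_id h
  have h1 := γ.toFun_eq_of_eventuallyEq (p := p ∘ f) (D.plot_reparam hp hf) hp (x := x)
    (hfx.mono fun y hy ↦ by rw [Function.comp_apply, hy])
  have h2 := γ.toFun_eq_of_eventuallyEq (p := q ∘ f) (D.plot_reparam hq hf) hq (x := x)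
    (hfx.mono fun y hy ↦ by rw [Function.comp_apply, hy])
  rw [← h1, ← h2]
  exact congrFun (hγ d _ _ _ _ (funext hfu)) x

theorem descends_pullback {π : X → Y} (hπ : @Diffeology.DSmooth X Y D D' π) (β : DiffForm D' k) :
    (β.pullback π hπ).Descends π :=
  fun _ _ _ _ _ h ↦ β.toFun_congr h _ _

/-- The form on `Y` whose pullback is a given form on `X` that descends. -/
def descend (π : X → Y) (hlift : ∀ (d : ℕ), ∀ r ∈ D'.plots d, LiftsLocally D π r)
    (γ : DiffForm D k) (hγ : γ.Descends π) : DiffForm D' k where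
  toFun d r hr x := γ.toFun d (hlift d r hr x).choose (hlift d r hr x).choose_spec.1 x
  contDiff d r hr := by
    refine contDiff_iff_contDiffAt.2 fun x₀ ↦ ?_
    -- The lift is chosen separately at each point. The one chosen at `x₀` still lifts `r` near
    -- every nearby `x`, and by descent it gives the same value there.
    have h₀ := (hlift d r hr x₀).choose_spec
    refine (γ.contDiff d _ h₀.1).contDiffAt.congr_of_eventuallyEq ?_
    filter_upwards [h₀.2.eventually_nhds] with x hx
    refine hγ.toFun_eq _ _ ?_
    filter_upwards [hx, (hlift d r hr x).choose_spec.2] with y h1 h2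
    rw [← h1, ← h2]
  reparam d e r hr f hf x := by
    have h₁ := (hlift d r hr (f x)).choose_spec
    have h₂ := (hlift e (r ∘ f) (D'.plot_reparam hr hf) x).choose_spec
    rw [← γ.reparam d e _ h₁.1 f hf x]
    refine hγ.toFun_eq _ _ ?_
    filter_upwards [h₂.2, hf.continuous.continuousAt.eventually h₁.2] with y h3 h4
    rw [← h3, Function.comp_apply, Function.comp_apply, h4]

theorem pullback_descend {π : X → Y} (hπ : @Diffeology.DSmooth X Y D D' π)
    (hlift : ∀ (d : ℕ), ∀ r ∈ D'.plots d, LiftsLocally D π r)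
    (γ : DiffForm D k) (hγ : γ.Descends π) : (descend π hlift γ hγ).pullback π hπ = γ := by
  refine DiffForm.ext (funext fun d ↦ funext fun p ↦ funext fun hp ↦ funext fun x ↦ ?_)
  have h := (hlift d (π ∘ p) (hπ d p hp) x).choose_spec
  exact hγ.toFun_eq h.1 hp (h.2.mono fun y hy ↦ hy.symm)

/-- Values depend only on germs of plots, and every germ of a plot of `Y` is the projection of one
of `X`. -/
theorem pullback_injective {π : X → Y} (hπ : @Diffeology.DSmooth X Y D D' π)
    (hlift : ∀ (d : ℕ), ∀ r ∈ D'.plots d, LiftsLocally D π r) :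
    Function.Injective (DiffForm.pullback (k := k) π hπ) := by
  intro β β' h
  refine DiffForm.ext (funext fun d ↦ funext fun r ↦ funext fun hr ↦ funext fun x ↦ ?_)
  obtain ⟨p, hp, hpr⟩ := hlift d r hr x
  rw [β.toFun_eq_of_eventuallyEq hr (hπ d p hp) hpr,
    β'.toFun_eq_of_eventuallyEq hr (hπ d p hp) hpr]
  exact congrArg (fun γ : DiffForm D k ↦ γ.toFun d p hp x) h

/-- This criterion serves twice: for the projection to an orbit space and for an anchor of a
bibundle. -/
theorem mem_range_pullback_iff {π : X → Y} (hπ : @Diffeology.DSmooth X Y D D' π)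
    (hlift : ∀ (d : ℕ), ∀ r ∈ D'.plots d, LiftsLocally D π r) (γ : DiffForm D k) :
    γ ∈ Set.range (DiffForm.pullback π hπ) ↔ γ.Descends π := by
  constructor
  · rintro ⟨β, rfl⟩
    exact descends_pullback hπ β
  · exact fun h ↦ ⟨_, pullback_descend hπ hlift γ h⟩

end DiffForm

/-! ### Diffeological forms on a manifold are differential forms -/

section ManifoldPlots

variable {n : ℕ} {M : Type*} [TopologicalSpace M] [ChartedSpace (EuclideanSpace ℝ (Fin n)) M]

/-- A map that is smooth near a point agrees near this point with a globally smooth map. -/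
theorem ContMDiffOn.exists_contMDiff_eventuallyEq {d : ℕ} {u : Set (EuclideanSpace ℝ (Fin d))}
    {x : EuclideanSpace ℝ (Fin d)} {g : EuclideanSpace ℝ (Fin d) → M}
    (hg : ContMDiffOn (𝓡 d) (𝓡 n) ∞ g u) (hu : u ∈ 𝓝 x) :
    ∃ g' : EuclideanSpace ℝ (Fin d) → M, ContMDiff (𝓡 d) (𝓡 n) ∞ g' ∧ g' =ᶠ[𝓝 x] g := by
  obtain ⟨f, hf, hfu, hfx⟩ := exists_contDiff_into_eventually_id hu
  refine ⟨g ∘ f, hg.comp_contMDiff hf.contMDiff hfu, ?_⟩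
  filter_upwards [hfx] with y hy
  rw [Function.comp_apply, hy]

variable [IsManifold (𝓡 n) ∞ M]

/-- The inverse of a chart agrees, near a given point of its domain, with a plot. -/
theorem exists_plot_eventuallyEq_extChartAt_symm (x : M) {z : EuclideanSpace ℝ (Fin n)}
    (hz : z ∈ (extChartAt (𝓡 n) x).target) :
    ∃ p : EuclideanSpace ℝ (Fin n) → M, ContMDiff (𝓡 n) (𝓡 n) ∞ p ∧
      p =ᶠ[𝓝 z] (extChartAt (𝓡 n) x).symm :=
  (contMDiffOn_extChartAt_symm x).exists_contMDiff_eventuallyEq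
    ((isOpen_extChartAt_target x).mem_nhds hz)

variable (n) in
/-- A plot that agrees near `x` with the inverse of the preferred chart at `x`. -/
def chartPlot (x : M) : EuclideanSpace ℝ (Fin n) → M :=
  (exists_plot_eventuallyEq_extChartAt_symm x (mem_extChartAt_target x)).choose

theorem contMDiff_chartPlot (x : M) : ContMDiff (𝓡 n) (𝓡 n) ∞ (chartPlot n x) :=
  (exists_plot_eventuallyEq_extChartAt_symm x (mem_extChartAt_target x)).choose_spec.1

theorem chartPlot_eventuallyEq (x : M) :
    chartPlot n x =ᶠ[𝓝 (extChartAt (𝓡 n) x x)] (extChartAt (𝓡 n) x).symm :=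
  (exists_plot_eventuallyEq_extChartAt_symm x (mem_extChartAt_target x)).choose_spec.2

theorem chartPlot_extChartAt (x : M) : chartPlot n x (extChartAt (𝓡 n) x x) = x := by
  rw [(chartPlot_eventuallyEq x).self_of_nhds, extChartAt_to_inv]

theorem mfderiv_chartPlot_surjective (x : M) :
    Function.Surjective (mfderiv (𝓡 n) (𝓡 n) (chartPlot n x) (extChartAt (𝓡 n) x x)) := by
  have : IsManifold (𝓡 n) 1 M := IsManifold.of_le (n := ∞) (by simp)
  rw [(chartPlot_eventuallyEq x).mfderiv_eq]
  have h := isInvertible_mfderivWithin_extChartAt_symm (I := 𝓡 n) (mem_extChartAt_target (I := 𝓡 n) x)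
  rw [ModelWithCorners.range_eq_univ, mfderivWithin_univ] at h
  exact h.bijective.surjective

namespace DiffForm

variable {k : ℕ}

/-- The value at `x` of a diffeological form on a manifold. -/
def atPoint (γ : DiffForm (manifoldDiffeology n M) k) (x : M) :
    TangentSpace (𝓡 n) x [⋀^Fin k]→L[ℝ] ℝ :=
  γ.toFun n (chartPlot n x) (contMDiff_chartPlot x) (extChartAt (𝓡 n) x x)

/-- Near `y` the plot `q` factors through the chart plot at `q y`, the other factor `g` being its
chart expression. The derivative of `g` is `mfderiv` of `q`, because the tangent space at `q y` is
modelled by that same chart. -/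
theorem toFun_eq_atPoint (γ : DiffForm (manifoldDiffeology n M) k) {d : ℕ}
    {q : EuclideanSpace ℝ (Fin d) → M} (hq : ContMDiff (𝓡 d) (𝓡 n) ∞ q)
    (y : EuclideanSpace ℝ (Fin d)) :
    γ.toFun d q hq y = ContinuousAlternatingMap.compContinuousLinearMap
      (γ.atPoint (q y)) (mfderiv (𝓡 d) (𝓡 n) q y) := by
  have hqy : q ⁻¹' (chartAt (EuclideanSpace ℝ (Fin n)) (q y)).source ∈ 𝓝 y :=
    hq.continuous.continuousAt.preimage_mem_nhds (chart_source_mem_nhds _ _)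
  have h1 : ContMDiffOn (𝓡 d) (𝓡 n) ∞ (extChartAt (𝓡 n) (q y) ∘ q)
      (q ⁻¹' (chartAt (EuclideanSpace ℝ (Fin n)) (q y)).source) :=
    (contMDiffOn_extChartAt (I := 𝓡 n) (x := q y)).comp hq.contMDiffOn subset_rfl
  obtain ⟨g, hg, hgy⟩ := h1.exists_contMDiff_eventuallyEq hqy
  have hg' : ContDiff ℝ ∞ g := hg.contDiff
  have hgv : g y = extChartAt (𝓡 n) (q y) (q y) := hgy.self_of_nhds
  have hder : mfderiv (𝓡 d) (𝓡 n) q y = fderiv ℝ g y := by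
    rw [hgy.fderiv_eq, ((hq y).mdifferentiableAt (by simp)).mfderiv,
      ModelWithCorners.range_eq_univ, fderivWithin_univ]
    rfl
  have hcp : ∀ᶠ z in 𝓝 y, q z = (chartPlot n (q y) ∘ g) z := by
    have hc := chartPlot_eventuallyEq (n := n) (q y)
    rw [← hgv] at hc
    filter_upwards [hg.continuous.continuousAt.eventually hc, hgy, hqy] with z h2 h3 h4
    rw [Function.comp_apply, h2, h3, Function.comp_apply, PartialEquiv.left_inv]
    rwa [extChartAt_source]
  rw [γ.toFun_eq_of_eventuallyEq hq
    ((manifoldDiffeology n M).plot_reparam (contMDiff_chartPlot (q y)) hg') hcp,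
    γ.reparam n d _ (contMDiff_chartPlot (q y)) g hg', hder, hgv]
  rfl

/-- The differential form on a manifold determined by a diffeological form. -/
def toManifoldForm (γ : DiffForm (manifoldDiffeology n M) k) : ManifoldForm n k M where
  toFun := γ.atPoint
  contMDiff_toFun := by
    intro x₀
    have : IsManifold (𝓡 n) 1 M := IsManifold.of_le (n := ∞) (by simp)
    refine (Bundle.contMDiffAt_section x₀).2 ?_
    have h1 : ContMDiffAt (𝓡 n) 𝓘(ℝ, EuclideanSpace ℝ (Fin n) [⋀^Fin k]→L[ℝ] ℝ) ∞
        (γ.toFun n (chartPlot n x₀) (contMDiff_chartPlot x₀) ∘ extChartAt (𝓡 n) x₀) x₀ :=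
      (γ.contDiff n _ _).contMDiff.contMDiffAt.comp x₀ contMDiffAt_extChartAt
    refine h1.congr_of_eventuallyEq ?_
    have h2 := (continuousAt_extChartAt (I := 𝓡 n) x₀).eventually
      (chartPlot_eventuallyEq x₀).eventually_nhds
    filter_upwards [h2, chart_source_mem_nhds (EuclideanSpace ℝ (Fin n)) x₀] with x hx hxs
    have hpx : chartPlot n x₀ (extChartAt (𝓡 n) x₀ x) = x := by
      rw [hx.self_of_nhds, PartialEquiv.left_inv]
      rwa [extChartAt_source]
    -- `atPoint` uses a chart that varies with `x`. In the trivialization at `x₀` its values become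
    -- those of `γ` on the single plot `chartPlot n x₀`, which are smooth in `x`.
    have hd : (trivializationAt (EuclideanSpace ℝ (Fin n)) (TangentSpace (𝓡 n)) x₀).symmL ℝ x =
        mfderiv (𝓡 n) (𝓡 n) (chartPlot n x₀) (extChartAt (𝓡 n) x₀ x) := by
      rw [TangentBundle.symmL_trivializationAt hxs, ModelWithCorners.range_eq_univ,
        mfderivWithin_univ, Filter.EventuallyEq.mfderiv_eq hx]
    rw [Function.comp_apply, γ.toFun_eq_atPoint (contMDiff_chartPlot x₀)]
    ext v
    simp only [FiberBundle.trivializationAt_continuousAlternatingMap_apply,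
      ContinuousAlternatingMap.inCoordinates,
      Bundle.Trivial.continuousLinearMapAt_trivialization,
      Bundle.Trivial.fiberBundle_trivializationAt', hd]
    have key (y : M) (hy : y = x) (w : Fin k → EuclideanSpace ℝ (Fin n)) :
        γ.atPoint x w = γ.atPoint y w := by rw [hy]
    exact key _ hpx _

theorem toDiffForm_toManifoldForm (γ : DiffForm (manifoldDiffeology n M) k) :
    γ.toManifoldForm.toDiffForm = γ :=
  DiffForm.ext (funext fun _ ↦ funext fun _ ↦ funext fun hq ↦ funext fun y ↦
    (γ.toFun_eq_atPoint hq y).symm)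

end DiffForm

/-- The pullback of a differential form along `f ∘ h` is the pullback along `h` of its pullback along
`f`. -/
theorem ManifoldForm.toDiffForm_toFun_comp {k m d : ℕ} {G : Type*} [TopologicalSpace G]
    [ChartedSpace (EuclideanSpace ℝ (Fin m)) G] [IsManifold (𝓡 m) ∞ G]
    (α : ManifoldForm n k M) {f : G → M} (hf : ContMDiff (𝓡 m) (𝓡 n) ∞ f)
    {h : EuclideanSpace ℝ (Fin d) → G} (hh : ContMDiff (𝓡 d) (𝓡 m) ∞ h)
    (x : EuclideanSpace ℝ (Fin d)) :
    α.toDiffForm.toFun d (f ∘ h) (hf.comp hh) x =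
      ContinuousAlternatingMap.compContinuousLinearMap
        (α.pullbackAt f (h x) : TangentSpace (𝓡 m) (h x) [⋀^Fin k]→L[ℝ] ℝ)
        (mfderiv (𝓡 d) (𝓡 m) h x) := by
  change ManifoldForm.pullbackAt (f ∘ h) α x = _
  unfold ManifoldForm.pullbackAt
  rw [mfderiv_comp x ((hf (h x)).mdifferentiableAt (by simp)) ((hh x).mdifferentiableAt (by simp))]
  rfl

end ManifoldPlots

/-! ### Local lifts along surjective submersions -/

section Submersion

variable {n d : ℕ} {M P : Type*}
  [TopologicalSpace M] [ChartedSpace (EuclideanSpace ℝ (Fin n)) M]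
  [TopologicalSpace P] [ChartedSpace (EuclideanSpace ℝ (Fin d)) P]

/-- The plots of the base of a surjective submersion lift locally to the total space. -/
theorem Manifold.IsSubmersion.liftsLocally {a : P → M} (ha : Manifold.IsSubmersion (𝓡 d) (𝓡 n) ∞ a)
    (hs : Function.Surjective a) {e : ℕ} {q : EuclideanSpace ℝ (Fin e) → M}
    (hq : ContMDiff (𝓡 e) (𝓡 n) ∞ q) :
    DiffForm.LiftsLocally (manifoldDiffeology d P) a q := by
  intro x
  obtain ⟨p₀, hp₀⟩ := hs (q x)
  have h := ha.isSubmersionAt p₀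
  set φ := h.domChart
  set ψ := h.codChart
  have hφs : p₀ ∈ φ.source := h.mem_domChart_source
  have hqs : q x ∈ ψ.source := hp₀ ▸ h.mem_codChart_source
  have hform : ∀ z ∈ φ.target, ψ (a (φ.symm z)) = (h.equiv z).1 := fun z hz ↦
    h.writtenInCharts (by simpa using! hz)
  -- In the charts, `a` is the projection onto the first factor. Freezing the second coordinate at
  -- its value at `p₀` gives a local section through `p₀`.
  let c := (h.equiv (φ p₀)).2
  let lift : EuclideanSpace ℝ (Fin n) → EuclideanSpace ℝ (Fin d) := fun z ↦ h.equiv.symm (z, c)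
  have hlift : ContDiff ℝ ∞ lift :=
    h.equiv.symm.contDiff.comp (contDiff_id.prodMk contDiff_const)
  have hψq : ContMDiffOn (𝓡 e) (𝓡 n) ∞ (ψ ∘ q) (q ⁻¹' ψ.source) :=
    (contMDiffOn_of_mem_maximalAtlas h.codChart_mem_maximalAtlas).comp hq.contMDiffOn subset_rfl
  have hopen : IsOpen (q ⁻¹' ψ.source) := ψ.open_source.preimage hq.continuous
  have hlq : ContMDiffOn (𝓡 e) (𝓡 d) ∞ (lift ∘ ψ ∘ q) (q ⁻¹' ψ.source) :=
    hlift.contMDiff.comp_contMDiffOn hψq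
  let u := q ⁻¹' ψ.source ∩ (lift ∘ ψ ∘ q) ⁻¹' φ.target
  have hu : IsOpen u := hlq.continuousOn.isOpen_inter_preimage hopen φ.open_target
  have hxval : lift (ψ (q x)) = φ p₀ := by
    have h1 := hform (φ p₀) (φ.map_source hφs)
    rw [φ.left_inv hφs, hp₀] at h1
    rw [h1]
    exact h.equiv.symm_apply_apply _
  have hxu : x ∈ u := ⟨hqs, by
    rw [Set.mem_preimage, Function.comp_apply, Function.comp_apply, hxval]
    exact φ.map_source hφs⟩
  have hg : ContMDiffOn (𝓡 e) (𝓡 d) ∞ (φ.symm ∘ lift ∘ ψ ∘ q) u :=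
    (contMDiffOn_symm_of_mem_maximalAtlas h.domChart_mem_maximalAtlas).comp
      (hlq.mono Set.inter_subset_left) Set.inter_subset_right
  obtain ⟨p, hp, hpx⟩ := hg.exists_contMDiff_eventuallyEq (hu.mem_nhds hxu)
  refine ⟨p, hp, ?_⟩
  filter_upwards [hpx, hu.mem_nhds hxu] with y hy hyu
  have hz : lift (ψ (q y)) ∈ φ.target := hyu.2
  rw [hy]
  refine ψ.injOn hyu.1 (h.source_subset_preimage_source (φ.map_target hz)) ?_
  change ψ (q y) = ψ (a (φ.symm (lift (ψ (q y)))))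
  rw [hform _ hz]
  exact (congrArg Prod.fst (h.equiv.apply_symm_apply (ψ (q y), c))).symm

end Submersion

theorem ContMDiff.dSmooth {n d : ℕ} {M P : Type*}
    [TopologicalSpace M] [ChartedSpace (EuclideanSpace ℝ (Fin n)) M]
    [TopologicalSpace P] [ChartedSpace (EuclideanSpace ℝ (Fin d)) P] {a : P → M}
    (ha : ContMDiff (𝓡 d) (𝓡 n) ∞ a) :
    @Diffeology.DSmooth P M (manifoldDiffeology d P) (manifoldDiffeology n M) a :=
  fun _ _ hp ↦ ha.comp hp

/-! ### Basic forms and forms on the orbit space -/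

namespace LieGroupoid

variable {n m : ℕ} {M G : Type*}
  [TopologicalSpace M] [ChartedSpace (EuclideanSpace ℝ (Fin n)) M] [IsManifold (𝓡 n) ∞ M]
  [T2Space M] [SecondCountableTopology M]
  [TopologicalSpace G] [ChartedSpace (EuclideanSpace ℝ (Fin m)) G] [IsManifold (𝓡 m) ∞ G]
  (𝓖 : LieGroupoid n m M G) {k : ℕ}

/-- A form is basic iff its pullbacks along the source and target of each smooth family of arrows
agree. -/
theorem isBasic_iff_toFun_eq (α : ManifoldForm n k M) :
    𝓖.IsBasic α ↔ ∀ (d : ℕ) (g : EuclideanSpace ℝ (Fin d) → G) (hg : ContMDiff (𝓡 d) (𝓡 m) ∞ g),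
      α.toDiffForm.toFun d (𝓖.src ∘ g) (𝓖.smooth_src.comp hg) =
        α.toDiffForm.toFun d (𝓖.tgt ∘ g) (𝓖.smooth_tgt.comp hg) := by
  constructor
  · intro h d g hg
    funext x
    rw [α.toDiffForm_toFun_comp 𝓖.smooth_src hg, α.toDiffForm_toFun_comp 𝓖.smooth_tgt hg, h (g x)]
  · intro h g₀
    -- The chart plot through `g₀` has surjective derivative there, so equality after pullback along
    -- it can be cancelled. The arrow `g` is kept variable because the types of both sides depend on
    -- it.
    have key (g : G) (z : EuclideanSpace ℝ (Fin m)) (hz : chartPlot m g₀ z = g)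
        (hsurj : Function.Surjective (mfderiv (𝓡 m) (𝓡 m) (chartPlot m g₀) z)) :
        (α.pullbackAt 𝓖.src g : TangentSpace (𝓡 m) g [⋀^Fin k]→L[ℝ] ℝ) =
          α.pullbackAt 𝓖.tgt g := by
      subst hz
      have h1 := congrFun (h m (chartPlot m g₀) (contMDiff_chartPlot g₀)) z
      rw [α.toDiffForm_toFun_comp 𝓖.smooth_src (contMDiff_chartPlot g₀),
        α.toDiffForm_toFun_comp 𝓖.smooth_tgt (contMDiff_chartPlot g₀)] at h1
      ext v
      choose w hw using fun i ↦ hsurj (v i)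
      have h2 := congrArg (fun θ : EuclideanSpace ℝ (Fin m) [⋀^Fin k]→L[ℝ] ℝ ↦ θ w) h1
      obtain rfl : (fun i ↦ mfderiv (𝓡 m) (𝓡 m) (chartPlot m g₀) z (w i)) = v := funext hw
      exact h2
    exact key g₀ _ (chartPlot_extChartAt g₀) (mfderiv_chartPlot_surjective g₀)

theorem orbitPullback_injective (k : ℕ) : Function.Injective (𝓖.orbitPullback k) :=
  DiffForm.pullback_injective _ fun _ _ hr ↦ hr

theorem mapsTo_orbitPullback (k : ℕ) :
    Set.MapsTo (𝓖.orbitPullback k) Set.univ (𝓖.basicForms k) := by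
  intro β _
  refine ⟨(𝓖.orbitPullback k β).toManifoldForm, ?_, DiffForm.toDiffForm_toManifoldForm _⟩
  rw [isBasic_iff_toFun_eq, DiffForm.toDiffForm_toManifoldForm]
  intro d g hg
  exact β.toFun_congr (funext fun x ↦ Quotient.sound ⟨g x, rfl, rfl⟩) _ _

/-- A basic form is pulled back from the orbit space iff it agrees on plots with the same
projection. -/
theorem surjectsOntoBasicForms_iff :
    𝓖.SurjectsOntoBasicForms k ↔ ∀ α : ManifoldForm n k M, 𝓖.IsBasic α →
      α.toDiffForm.Descends (Quotient.mk 𝓖.orbitSetoid) := by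
  have hr (γ : DiffForm (manifoldDiffeology n M) k) :
      γ ∈ 𝓖.orbitPullback k '' Set.univ ↔ γ.Descends (Quotient.mk 𝓖.orbitSetoid) := by
    rw [Set.image_univ]
    exact DiffForm.mem_range_pullback_iff _ (fun _ _ hr ↦ hr) γ
  constructor
  · exact fun h α hα ↦ (hr _).1 (h ⟨α, hα, rfl⟩)
  · rintro h _ ⟨α, hα, rfl⟩
    exact (hr _).2 (h α hα)

theorem propertyP_iff : 𝓖.PropertyP ↔ ∀ k, 𝓖.SurjectsOntoBasicForms k :=
  ⟨fun h k ↦ (h k).surjOn, fun h k ↦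
    ⟨𝓖.mapsTo_orbitPullback k, (𝓖.orbitPullback_injective k).injOn, h k⟩⟩

end LieGroupoid

/-! ### Transfer of basic forms across a Morita equivalence -/

section Correspondence

variable {n m n' m' : ℕ} {M G N H : Type*}
  [TopologicalSpace M] [ChartedSpace (EuclideanSpace ℝ (Fin n)) M] [IsManifold (𝓡 n) ∞ M]
  [T2Space M] [SecondCountableTopology M]
  [TopologicalSpace G] [ChartedSpace (EuclideanSpace ℝ (Fin m)) G] [IsManifold (𝓡 m) ∞ G]
  [TopologicalSpace N] [ChartedSpace (EuclideanSpace ℝ (Fin n')) N] [IsManifold (𝓡 n') ∞ N]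
  [T2Space N] [SecondCountableTopology N]
  [TopologicalSpace H] [ChartedSpace (EuclideanSpace ℝ (Fin m')) H] [IsManifold (𝓡 m') ∞ H]

/-- A pair of surjective submersions onto the bases of two Lie groupoids such that smooth families
of arrows of each groupoid lift to smooth families of points in the fibres of the other submersion,
and conversely. This is what a Morita equivalence provides at the level of plots, in a form that is
symmetric in the two groupoids. -/
structure PlotCorrespondence (𝓖 : LieGroupoid n m M G) (𝓗 : LieGroupoid n' m' N H) (d : ℕ)
    (P : Type*) [TopologicalSpace P] [ChartedSpace (EuclideanSpace ℝ (Fin d)) P] where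
  left : P → M
  right : P → N
  submersion_left : Manifold.IsSubmersion (𝓡 d) (𝓡 n) ∞ left
  submersion_right : Manifold.IsSubmersion (𝓡 d) (𝓡 n') ∞ right
  surjective_left : Function.Surjective left
  surjective_right : Function.Surjective right
  smooth_left : ContMDiff (𝓡 d) (𝓡 n) ∞ left
  smooth_right : ContMDiff (𝓡 d) (𝓡 n') ∞ right
  exists_arrow_of_right_eq : ∀ (e : ℕ) (p q : EuclideanSpace ℝ (Fin e) → P),
    ContMDiff (𝓡 e) (𝓡 d) ∞ p → ContMDiff (𝓡 e) (𝓡 d) ∞ q → right ∘ p = right ∘ q →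
    ∃ g : EuclideanSpace ℝ (Fin e) → G, ContMDiff (𝓡 e) (𝓡 m) ∞ g ∧
      𝓖.src ∘ g = left ∘ p ∧ 𝓖.tgt ∘ g = left ∘ q
  exists_arrow_of_left_eq : ∀ (e : ℕ) (p q : EuclideanSpace ℝ (Fin e) → P),
    ContMDiff (𝓡 e) (𝓡 d) ∞ p → ContMDiff (𝓡 e) (𝓡 d) ∞ q → left ∘ p = left ∘ q →
    ∃ h : EuclideanSpace ℝ (Fin e) → H, ContMDiff (𝓡 e) (𝓡 m') ∞ h ∧
      𝓗.src ∘ h = right ∘ p ∧ 𝓗.tgt ∘ h = right ∘ q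
  exists_lift_left : ∀ (e : ℕ) (g : EuclideanSpace ℝ (Fin e) → G)
    (p : EuclideanSpace ℝ (Fin e) → P), ContMDiff (𝓡 e) (𝓡 m) ∞ g → ContMDiff (𝓡 e) (𝓡 d) ∞ p →
    𝓖.src ∘ g = left ∘ p → ∃ q : EuclideanSpace ℝ (Fin e) → P, ContMDiff (𝓡 e) (𝓡 d) ∞ q ∧
      left ∘ q = 𝓖.tgt ∘ g ∧ right ∘ q = right ∘ p
  exists_lift_right : ∀ (e : ℕ) (h : EuclideanSpace ℝ (Fin e) → H)
    (p : EuclideanSpace ℝ (Fin e) → P), ContMDiff (𝓡 e) (𝓡 m') ∞ h → ContMDiff (𝓡 e) (𝓡 d) ∞ p →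
    𝓗.src ∘ h = right ∘ p → ∃ q : EuclideanSpace ℝ (Fin e) → P, ContMDiff (𝓡 e) (𝓡 d) ∞ q ∧
      right ∘ q = 𝓗.tgt ∘ h ∧ left ∘ q = left ∘ p

namespace PlotCorrespondence

variable {𝓖 : LieGroupoid n m M G} {𝓗 : LieGroupoid n' m' N H} {d k : ℕ} {P : Type*}
  [TopologicalSpace P] [ChartedSpace (EuclideanSpace ℝ (Fin d)) P]

/-- The correspondence with the roles of the two groupoids exchanged. -/
def symm (C : PlotCorrespondence 𝓖 𝓗 d P) : PlotCorrespondence 𝓗 𝓖 d P where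
  left := C.right
  right := C.left
  submersion_left := C.submersion_right
  submersion_right := C.submersion_left
  surjective_left := C.surjective_right
  surjective_right := C.surjective_left
  smooth_left := C.smooth_right
  smooth_right := C.smooth_left
  exists_arrow_of_right_eq := C.exists_arrow_of_left_eq
  exists_arrow_of_left_eq := C.exists_arrow_of_right_eq
  exists_lift_left := C.exists_lift_right
  exists_lift_right := C.exists_lift_left

/-- Points over the same `𝓗`-orbit lie over the same `𝓖`-orbit. -/
theorem orbit_left_eq (C : PlotCorrespondence 𝓖 𝓗 d P) {p q : P}
    (hpq : Quotient.mk 𝓗.orbitSetoid (C.right p) = Quotient.mk 𝓗.orbitSetoid (C.right q)) :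
    Quotient.mk 𝓖.orbitSetoid (C.left p) = Quotient.mk 𝓖.orbitSetoid (C.left q) := by
  obtain ⟨h, hs, ht⟩ := Quotient.exact hpq
  -- Points are plots on `ℝ⁰`. The arrow `h` moves `p` inside its left fibre to a point with the
  -- same right projection as `q`.
  obtain ⟨p', hp', hr, hl⟩ := C.exists_lift_right 0 (fun _ ↦ h) (fun _ ↦ p) contMDiff_const
    contMDiff_const (funext fun _ ↦ hs)
  obtain ⟨g, -, hgs, hgt⟩ := C.exists_arrow_of_right_eq 0 p' (fun _ ↦ q) hp' contMDiff_const
    (hr.trans (funext fun _ ↦ ht))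
  exact Quotient.sound ⟨g 0, (congrFun hgs 0).trans (congrFun hl 0), congrFun hgt 0⟩

/-- A basic form on the base of `𝓗`, pulled back to `P`, is the pullback of a basic form on the base
of `𝓖`. -/
theorem exists_isBasic_pullback_eq (C : PlotCorrespondence 𝓖 𝓗 d P) {α : ManifoldForm n' k N}
    (hα : 𝓗.IsBasic α) : ∃ α' : ManifoldForm n k M, 𝓖.IsBasic α' ∧
      α'.toDiffForm.pullback C.left C.smooth_left.dSmooth =
        α.toDiffForm.pullback C.right C.smooth_right.dSmooth := by
  rw [LieGroupoid.isBasic_iff_toFun_eq] at hα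
  have hdesc : (α.toDiffForm.pullback C.right C.smooth_right.dSmooth).Descends C.left := by
    intro e p q hp hq hpq
    obtain ⟨h, hh, hs, ht⟩ := C.exists_arrow_of_left_eq e p q hp hq hpq
    exact (α.toDiffForm.toFun_congr hs _ (C.smooth_right.comp hp)).symm.trans
      ((hα e h hh).trans (α.toDiffForm.toFun_congr ht _ (C.smooth_right.comp hq)))
  have hlift : ∀ (e : ℕ), ∀ r ∈ (manifoldDiffeology n M).plots e,
      DiffForm.LiftsLocally (manifoldDiffeology d P) C.left r :=
    fun _ _ hr ↦ C.submersion_left.liftsLocally C.surjective_left hr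
  obtain ⟨β, hβ⟩ :=
    (DiffForm.mem_range_pullback_iff C.smooth_left.dSmooth hlift _).2 hdesc
  have hβ' : ∀ (e : ℕ) (p : EuclideanSpace ℝ (Fin e) → P) (hp : ContMDiff (𝓡 e) (𝓡 d) ∞ p),
      β.toFun e (C.left ∘ p) (C.smooth_left.comp hp) =
        α.toDiffForm.toFun e (C.right ∘ p) (C.smooth_right.comp hp) := fun e p hp ↦
    congrArg (fun γ : DiffForm (manifoldDiffeology d P) k ↦ γ.toFun e p hp) hβ
  refine ⟨β.toManifoldForm, ?_, by rw [DiffForm.toDiffForm_toManifoldForm, hβ]⟩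
  rw [LieGroupoid.isBasic_iff_toFun_eq, DiffForm.toDiffForm_toManifoldForm]
  intro e g hg
  funext x
  -- The sources of `g` are lifted to `P` near `x`, made global by `f`, and then moved by the arrows
  -- to `q`. The right projection does not change, so `β` takes the same value, that of `α`, on
  -- sources and targets.
  obtain ⟨p, hp, hpx⟩ := hlift e (𝓖.src ∘ g) (𝓖.smooth_src.comp hg) x
  obtain ⟨f, hf, hfu, hfx⟩ := exists_contDiff_into_eventually_id hpx
  have hgf := hg.comp hf.contMDiff
  have hpf := ContMDiff.comp hp hf.contMDiff
  obtain ⟨q, hq, hl, hr⟩ := C.exists_lift_left e (g ∘ f) (p ∘ f) hgf hpf (funext hfu)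
  have hfx' : ∀ᶠ y in 𝓝 x, g y = (g ∘ f) y :=
    hfx.mono fun y hy ↦ by rw [Function.comp_apply, hy]
  rw [β.toFun_eq_of_eventuallyEq (p := 𝓖.src ∘ g) (q := 𝓖.src ∘ g ∘ f) _ (𝓖.smooth_src.comp hgf)
      (hfx'.mono fun y hy ↦ congrArg 𝓖.src hy),
    β.toFun_eq_of_eventuallyEq (p := 𝓖.tgt ∘ g) (q := 𝓖.tgt ∘ g ∘ f) _ (𝓖.smooth_tgt.comp hgf)
      (hfx'.mono fun y hy ↦ congrArg 𝓖.tgt hy)]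
  refine congrFun ?_ x
  rw [β.toFun_congr (p := 𝓖.src ∘ g ∘ f) (q := C.left ∘ p ∘ f) (funext hfu) _
      (C.smooth_left.comp hpf), hβ' e _ hpf,
    ← β.toFun_congr hl (C.smooth_left.comp hq) _, hβ' e _ hq]
  exact α.toDiffForm.toFun_congr hr.symm _ _

/-- Lifting plots to `P` replaces `α` by `α'` on left projections. Only pointwise equality of orbits
passes to the other side, and this is all that descent of `α'` needs. -/
theorem surjectsOntoBasicForms (C : PlotCorrespondence 𝓖 𝓗 d P)
    (h𝓖 : 𝓖.SurjectsOntoBasicForms k) : 𝓗.SurjectsOntoBasicForms k := by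
  rw [LieGroupoid.surjectsOntoBasicForms_iff] at h𝓖 ⊢
  intro α hα e p q hp hq hpq
  obtain ⟨α', hα', hαα'⟩ := C.exists_isBasic_pullback_eq hα
  have key : ∀ (r : EuclideanSpace ℝ (Fin e) → P) (hr : ContMDiff (𝓡 e) (𝓡 d) ∞ r),
      α'.toDiffForm.toFun e (C.left ∘ r) (C.smooth_left.comp hr) =
        α.toDiffForm.toFun e (C.right ∘ r) (C.smooth_right.comp hr) := fun r hr ↦
    congrArg (fun γ : DiffForm (manifoldDiffeology d P) k ↦ γ.toFun e r hr) hαα'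
  funext x
  obtain ⟨p', hp', hpp'⟩ := C.submersion_right.liftsLocally C.surjective_right hp x
  obtain ⟨q', hq', hqq'⟩ := C.submersion_right.liftsLocally C.surjective_right hq x
  rw [α.toDiffForm.toFun_eq_of_eventuallyEq (q := C.right ∘ p') hp (C.smooth_right.comp hp') hpp',
    α.toDiffForm.toFun_eq_of_eventuallyEq (q := C.right ∘ q') hq (C.smooth_right.comp hq') hqq',
    ← key p' hp', ← key q' hq']
  refine (h𝓖 α' hα').toFun_eq _ _ ?_
  filter_upwards [hpp', hqq'] with y h1 h2
  refine C.orbit_left_eq ?_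
  rw [← h1, ← h2]
  exact congrFun hpq y

theorem surjectsOntoBasicForms_iff (C : PlotCorrespondence 𝓖 𝓗 d P) (k : ℕ) :
    𝓖.SurjectsOntoBasicForms k ↔ 𝓗.SurjectsOntoBasicForms k :=
  ⟨C.surjectsOntoBasicForms, C.symm.surjectsOntoBasicForms⟩

end PlotCorrespondence

/-- A biprincipal bibundle gives a correspondence of plots. -/
def Bibundle.plotCorrespondence {𝓖 : LieGroupoid n m M G} {𝓗 : LieGroupoid n' m' N H} {d : ℕ}
    {P : Type*} [TopologicalSpace P] [ChartedSpace (EuclideanSpace ℝ (Fin d)) P]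
    (B : Bibundle 𝓖 𝓗 d P) (hB : B.left.IsPrincipal n' B.right.anchor) :
    PlotCorrespondence 𝓖 𝓗 d P where
  left := B.left.anchor
  right := B.right.anchor
  submersion_left := B.principal_right.submersion
  submersion_right := hB.submersion
  surjective_left := B.principal_right.surjective
  surjective_right := hB.surjective
  smooth_left := B.left.smooth_anchor
  smooth_right := B.right.smooth_anchor
  exists_arrow_of_right_eq e p q hp hq hpq := by
    -- The inverse `f` sends `(q, p)` to `(g, p)` with `g · p = q`, so `g` runs from the left
    -- projection of `p` to that of `q`.
    obtain ⟨-, -, f, hf, hft, -, hfr⟩ := hB.diffeo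
    have hmem : ∀ x, (q x, p x) ∈ {r : P × P | B.right.anchor r.1 = B.right.anchor r.2} :=
      fun x ↦ (congrFun hpq x).symm
    have hsm := hf.comp_contMDiff (hq.prodMk hp) hmem
    have hsnd : ∀ x, (f (q x, p x)).2 = p x := fun x ↦ congrArg Prod.snd (hfr (hmem x))
    have hact : ∀ x, B.left.act (f (q x, p x)).1 (f (q x, p x)).2 = q x :=
      fun x ↦ congrArg Prod.fst (hfr (hmem x))
    have hsrc : ∀ x, 𝓖.src (f (q x, p x)).1 = B.left.anchor (f (q x, p x)).2 :=
      fun x ↦ hft (hmem x)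
    refine ⟨fun x ↦ (f (q x, p x)).1, contMDiff_fst.comp hsm, funext fun x ↦ ?_, funext fun x ↦ ?_⟩
    · rw [Function.comp_apply, hsrc, hsnd, Function.comp_apply]
    · rw [Function.comp_apply, ← B.left.anchor_act _ _ (hsrc x), hact, Function.comp_apply]
  exists_arrow_of_left_eq e p q hp hq hpq := by
    obtain ⟨-, -, f, hf, hft, -, hfr⟩ := B.principal_right.diffeo
    -- Here `q · h = p`. A right action carries the anchor from the target to the source of `h`, so
    -- `q` comes first in the pair to give an arrow from `p` to `q`.
    have hmem : ∀ x, (q x, p x) ∈ {r : P × P | B.left.anchor r.1 = B.left.anchor r.2} :=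
      fun x ↦ (congrFun hpq x).symm
    have hsm := hf.comp_contMDiff (hq.prodMk hp) hmem
    have hfst : ∀ x, (f (q x, p x)).1 = q x := fun x ↦ congrArg Prod.fst (hfr (hmem x))
    have hact : ∀ x, B.right.act (f (q x, p x)).1 (f (q x, p x)).2 = p x :=
      fun x ↦ congrArg Prod.snd (hfr (hmem x))
    have htgt : ∀ x, B.right.anchor (f (q x, p x)).1 = 𝓗.tgt (f (q x, p x)).2 :=
      fun x ↦ hft (hmem x)
    refine ⟨fun x ↦ (f (q x, p x)).2, contMDiff_snd.comp hsm, funext fun x ↦ ?_, funext fun x ↦ ?_⟩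
    · rw [Function.comp_apply, ← B.right.anchor_act _ _ (htgt x), hact, Function.comp_apply]
    · rw [Function.comp_apply, ← htgt, hfst, Function.comp_apply]
  exists_lift_left e g p hg hp hgp :=
    ⟨fun x ↦ B.left.act (g x) (p x),
      B.left.smooth_act.comp_contMDiff (hg.prodMk hp) (congrFun hgp),
      funext fun x ↦ B.left.anchor_act _ _ (congrFun hgp x),
      funext fun x ↦ hB.invariant _ _ (congrFun hgp x)⟩
  exists_lift_right e h p hh hp hhp := by
    -- The source of `h` lies under `p`, so the right action has to be by the inverse arrow.
    have hmem : ∀ x, B.right.anchor (p x) = 𝓗.tgt (𝓗.inv (h x)) := fun x ↦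
      (congrFun hhp x).symm.trans (𝓗.tgt_inv (h x)).symm
    exact ⟨fun x ↦ B.right.act (p x) (𝓗.inv (h x)),
      B.right.smooth_act.comp_contMDiff (hp.prodMk (𝓗.smooth_inv.comp hh)) hmem,
      funext fun x ↦ (B.right.anchor_act _ _ (hmem x)).trans (𝓗.src_inv (h x)),
      funext fun x ↦ B.principal_right.invariant _ _ (hmem x)⟩

end Correspondence

theorem corollary2 {n m n' m' : ℕ} {M G N H : Type*}
    [TopologicalSpace M] [ChartedSpace (EuclideanSpace ℝ (Fin n)) M] [IsManifold (𝓡 n) ∞ M]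
    [T2Space M] [SecondCountableTopology M]
    [TopologicalSpace G] [ChartedSpace (EuclideanSpace ℝ (Fin m)) G] [IsManifold (𝓡 m) ∞ G]
    [TopologicalSpace N] [ChartedSpace (EuclideanSpace ℝ (Fin n')) N] [IsManifold (𝓡 n') ∞ N]
    [T2Space N] [SecondCountableTopology N]
    [TopologicalSpace H] [ChartedSpace (EuclideanSpace ℝ (Fin m')) H] [IsManifold (𝓡 m') ∞ H]
    (𝓖 : LieGroupoid n m M G) (𝓗 : LieGroupoid n' m' N H) (h : MoritaEquivalent 𝓖 𝓗) :
    (∀ k : ℕ, 𝓖.SurjectsOntoBasicForms k ↔ 𝓗.SurjectsOntoBasicForms k) ∧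
      (𝓖.PropertyP ↔ 𝓗.PropertyP) := by
  obtain ⟨d, P, _, _, _, B, hB⟩ := h
  have key := (B.plotCorrespondence hB).surjectsOntoBasicForms_iff
  exact ⟨key, by rw [𝓖.propertyP_iff, 𝓗.propertyP_iff, forall_congr' key]⟩

end
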